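/- All graphs are finite and simple. A graph is \emph{nice} if no connected component of it is isomorphic to $K_2$; it is \emph{$d$-degenerate} if every nonempty induced subgraph has a vertex of degree at most $d$ in that subgraph. The colouring number $\mathrm{col}(G)$ is the least $k$ for which the vertices of $G$ can be linearly ordered so that every vertex has fewer than $k$ neighbours preceding it. A graph $G$ is \emph{$(k,l)$-weight choosable} if for every assignment of a set $L_v$ of $k$ real numbers to each vertex $v$ and a set $L_e$ of $l$ real numbers to each edge $e$ one can choose $w(v)\in L_v$ and $w(e)\in L_e$ for all vertices $v$ and edges $e$ such that $w(u)+\sum_{e\ni u}w(e)\neq w(v)+\sum_{e\ni v}w(e)$ for all adjacent $u,v$. The edge weight choosability number $\mathrm{ch}^e_\Sigma(G)$ is the least $k$ such that for every assignment of a set $L_e$ of $k$ real numbers to each edge $e$ one can choose $w(e)\in L_e$ for all edges $e$ with $\sum_{e\ni u}w(e)\neq\sum_{e\ni v}w(e)$ for all adjacent $u,v$ ($\infty$ if there is no such $k$). \textbf{Corollary.} Let $G$ be a nice $d$-degenerate graph with maximum degree $\Delta(G)$. Then $G$ is $(1,\Delta(G)+d+1)$-weight choosable. Likewise, in terms of the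 colouring number, $G$ is $(1,\Delta(G)+\mathrm{col}(G))$-weight choosable. In particular, $\mathrm{ch}^e_\Sigma(G)\le\Delta(G)+d+1$. -/

import Mathlib

namespace SimpleGraph

variable {V : Type*}

/-- A graph is *nice* if none of its connected components is isomorphic to `K₂`. -/
def IsNice (G : SimpleGraph V) : Prop :=
  ∀ c : G.ConnectedComponent, ¬ Nonempty (c.toSimpleGraph ≃g completeGraph (Fin 2))

/-- A graph is `d`-*degenerate* if every (nonempty) induced subgraph has a vertex whose degree in
that subgraph is at most `d`. -/
def IsDegenerate (G : SimpleGraph V) (d : ℕ) : Prop :=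
  ∀ s : Set V, s.Nonempty → ∃ v : s, ((G.induce s).neighborSet v).encard ≤ d

/-- The *colouring number* `col(G)` of a finite graph: the least `k` such that the vertices can be
enumerated so that each vertex has fewer than `k` neighbours preceding it. -/
noncomputable def colouringNumber [Fintype V] (G : SimpleGraph V) : ℕ :=
  sInf {k : ℕ | ∃ σ : V ≃ Fin (Fintype.card V),
    ∀ v : V, {u : V | G.Adj v u ∧ σ u < σ v}.encard < k}

section Weights

variable [Fintype V] [DecidableEq V] (G : SimpleGraph V) [DecidableRel G.Adj]

/-- The colour `∑_{e ∋ v} w(e)` given to `v` by edge weights `w`. Only the values of `w` at edges of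
`G` matter. -/
def edgeSum (w : Sym2 V → ℝ) (v : V) : ℝ :=
  ∑ e ∈ G.incidenceFinset v, w e

/-- `G` is `(k, l)`-*weight choosable*: for every assignment of lists of `k` real numbers to the
vertices and lists of `l` real numbers to the edges, there is a choice of one weight from each list
such that `v ↦ w(v) + ∑_{e ∋ v} w(e)` is a proper vertex colouring. Lists and weights at elements
of `Sym2 V` that are not edges of `G` are irrelevant. -/
def IsWeightChoosable (k l : ℕ) : Prop :=
  ∀ (LV : V → Finset ℝ) (LE : Sym2 V → Finset ℝ),
    (∀ v, (LV v).card = k) → (∀ e ∈ G.edgeSet, (LE e).card = l) →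
    ∃ (wV : V → ℝ) (wE : Sym2 V → ℝ),
      (∀ v, wV v ∈ LV v) ∧ (∀ e ∈ G.edgeSet, wE e ∈ LE e) ∧
      ∀ u v, G.Adj u v → wV u + G.edgeSum wE u ≠ wV v + G.edgeSum wE v

/-- Every assignment of lists of `k` real numbers to the edges of `G` admits a choice of one weight
from each list such that `v ↦ ∑_{e ∋ v} w(e)` is a proper vertex colouring. -/
def IsEdgeWeightChoosable (k : ℕ) : Prop :=
  ∀ LE : Sym2 V → Finset ℝ, (∀ e ∈ G.edgeSet, (LE e).card = k) →
    ∃ wE : Sym2 V → ℝ, (∀ e ∈ G.edgeSet, wE e ∈ LE e) ∧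
      ∀ u v, G.Adj u v → G.edgeSum wE u ≠ G.edgeSum wE v

/-- The *edge weight choosability number*: the least `k` such that `G` is edge weight choosable from
lists of size `k`, and `⊤` if there is no such `k`. -/
noncomputable def edgeWeightChoosabilityNumber : ℕ∞ :=
  ⨅ k ∈ {k : ℕ | G.IsEdgeWeightChoosable k}, (k : ℕ∞)

end Weights

end SimpleGraph

namespace SimpleGraph

/-! Weigh the edges greedily. The weight of an edge e = uv adds equally to the colours of u and v,
so the conflict on e depends only on edges sharing exactly one end with e; niceness provides one.
The last such edge, `ρ e`, changes one of the two colours, so at most one of its values is bad for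
e. Number the vertices with back-degrees at most d and order edges lexicographically, smaller end
first: then each edge is `ρ e` for at most Δ + d edges e (`exists_card_le_of_last_edgeTouch`), and
lists of size Δ + d + 1 suffice. -/

/-- Greedy choice from lists: if each constraint `c` becomes decided at the variable `ρ c`, whose
value then violates `c` for at most one choice, and the list at each variable is longer than the
number of constraints decided there, then all constraints can be met. -/
theorem exists_forall_mem_forall_not_bad {E C ι R : Type*} [DecidableEq E] [Inhabited R]
    [LinearOrder ι] (key : E → ι) (s : Finset E) (t : Finset C) (L : E → Finset R) (ρ : C → E)
    (Bad : C → (E → R) → Prop)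
    (indep : ∀ c ∈ t, ∀ f, f ≠ ρ c → key (ρ c) ≤ key f → ∀ w x,
      Bad c (Function.update w f x) ↔ Bad c w)
    (uniq : ∀ c ∈ t, ∀ w x y, Bad c (Function.update w (ρ c) x) →
      Bad c (Function.update w (ρ c) y) → x = y)
    (card_lt : ∀ f ∈ s, ∃ B : Finset C, (∀ c ∈ t, ρ c = f → c ∈ B) ∧ B.card < (L f).card) :
    ∃ w : E → R, (∀ f ∈ s, w f ∈ L f) ∧ ∀ c ∈ t, ρ c ∈ s → ¬ Bad c w := by
  classical
  induction s using Finset.induction_on_max_value key with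
  | empty => exact ⟨fun _ => default, by simp, by simp⟩
  | insert a s ha hmax ih =>
    obtain ⟨w, hw, hbad⟩ := ih fun f hf => card_lt f (Finset.mem_insert_of_mem hf)
    obtain ⟨B, hB, hBcard⟩ := card_lt a (Finset.mem_insert_self a s)
    have key_exists : ∃ x ∈ L a, ∀ c ∈ t, ρ c = a → ¬ Bad c (Function.update w a x) := by
      by_contra! h
      obtain ⟨x₀, hx₀⟩ := Finset.card_pos.1 (Nat.zero_lt_of_lt hBcard)
      have : Nonempty C := ⟨(h x₀ hx₀).choose⟩
      choose! g hgt hga hg using h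
      -- If every value were blocked, sending each value to a constraint it violates would inject `L
      -- a` into `B`.
      refine hBcard.not_ge (Finset.card_le_card_of_injOn g (fun x hx => ?_) fun x hx y hy hxy => ?_)
      · exact hB _ (hgt x hx) (hga x hx)
      · refine uniq (g x) (hgt x hx) w x y ?_ ?_
        · rw [hga x hx]; exact hg x hx
        · rw [hga x hx, hxy]; exact hg y hy
    obtain ⟨x, hx, hxbad⟩ := key_exists
    refine ⟨Function.update w a x, fun f hf => ?_, fun c hc hcs => ?_⟩
    · rcases Finset.mem_insert.1 hf with rfl | hf
      · simpa using hx
      · rw [Function.update_of_ne (ne_of_mem_of_not_mem hf ha)]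
        exact hw f hf
    · rcases Finset.mem_insert.1 hcs with h | h
      · exact hxbad c hc h
      · rw [indep c hc a (ne_of_mem_of_not_mem h ha).symm (hmax _ h)]
        exact hbad c hc h

/-! ### Nice graphs and vertex orderings -/

variable {V : Type*}

/-- Two distinct edges sharing a vertex. -/
def EdgeTouch (e f : Sym2 V) : Prop := e ≠ f ∧ ∃ v, v ∈ e ∧ v ∈ f

/-- In a nice graph every edge meets another edge. -/
theorem IsNice.exists_edgeTouch {G : SimpleGraph V} (hG : G.IsNice) {e : Sym2 V}
    (he : e ∈ G.edgeSet) : ∃ f ∈ G.edgeSet, EdgeTouch e f := by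
  classical
  induction e with | _ u v
  rw [mem_edgeSet] at he
  by_contra! h
  have hu : ∀ x, G.Adj u x → x = v := fun x hx => by
    by_contra hxv
    refine h s(u, x) hx ⟨fun h => hxv ?_, u, by simp, by simp⟩
    exact (Sym2.congr_right.1 h).symm
  have hv : ∀ x, G.Adj v x → x = u := fun x hx => by
    by_contra hxu
    refine h s(v, x) hx ⟨fun h => hxu ?_, v, by simp, by simp⟩
    rw [Sym2.eq_swap] at h
    exact (Sym2.congr_right.1 h).symm
  -- With no edge touching uv, the component is {u, v}, a copy of K₂.
  have hreach : ∀ x, G.Reachable u x → x = u ∨ x = v := by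
    rintro x hx
    rw [reachable_iff_reflTransGen] at hx
    induction hx with
    | refl => exact Or.inl rfl
    | tail _ hyz ih =>
      rcases ih with rfl | rfl
      · exact Or.inr (hu _ hyz)
      · exact Or.inl (hv _ hyz)
  have hsupp : (G.connectedComponentMk u).supp = {u, v} := by
    ext x
    simp only [ConnectedComponent.mem_supp_iff, ConnectedComponent.eq, Set.mem_insert_iff,
      Set.mem_singleton_iff]
    refine ⟨fun hx => hreach x hx.symm, ?_⟩
    rintro (rfl | rfl)
    · exact Reachable.refl _
    · exact he.symm.reachable
  have hmem : ∀ x : (G.connectedComponentMk u).supp, x.1 = u ∨ x.1 = v := fun x => by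
    simpa using hsupp.subset x.2
  have hcard : Nat.card (G.connectedComponentMk u).supp = 2 := by
    rw [Nat.card_coe_set_eq, hsupp, Set.ncard_pair he.ne]
  have : Finite (G.connectedComponentMk u).supp := by
    rw [hsupp]; infer_instance
  refine hG (G.connectedComponentMk u) ⟨⟨Finite.equivFinOfCardEq hcard, ?_⟩⟩
  intro x y
  change (⊤ : SimpleGraph (Fin 2)).Adj _ _ ↔ G.Adj x.1 y.1
  rw [top_adj, (Finite.equivFinOfCardEq hcard).injective.ne_iff, ne_eq, Subtype.ext_iff]
  rcases hmem x with hx | hx <;> rcases hmem y with hy | hy <;> rw [hx, hy] <;>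
    simp [he, he.symm, he.ne, he.ne.symm]

/-- A `d`-degenerate finite graph has a vertex ordering with back-degrees at most `d`. -/
theorem IsDegenerate.exists_ordering [Fintype V] {G : SimpleGraph V} {d : ℕ}
    (hd : G.IsDegenerate d) :
    ∃ σ : V → ℕ, Function.Injective σ ∧ ∀ v, {u | G.Adj v u ∧ σ u < σ v}.encard ≤ d := by
  classical
  suffices H : ∀ (n : ℕ) (s : Finset V), s.card = n → ∃ σ : V → ℕ, Set.InjOn σ s ∧
      ∀ v ∈ s, {u | u ∈ s ∧ G.Adj v u ∧ σ u < σ v}.encard ≤ d by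
    obtain ⟨σ, hσ, h⟩ := H _ Finset.univ rfl
    exact ⟨σ, by simpa using hσ, by simpa using h⟩
  intro n
  induction n with
  | zero =>
    intro s hs
    rw [Finset.card_eq_zero] at hs
    subst hs
    exact ⟨fun _ => 0, by simp, by simp⟩
  | succ n ih =>
    intro s hs
    have hne : (s : Set V).Nonempty := by
      rw [Finset.coe_nonempty, ← Finset.card_pos]; omega
    obtain ⟨⟨v, hv⟩, hvd⟩ := hd s hne
    have hv' : v ∈ s := hv
    obtain ⟨σ, hσ, hσd⟩ := ih (s.erase v) (by rw [Finset.card_erase_of_mem hv', hs]; rfl)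
    have hlt : ∀ u ∈ s, u ≠ v → σ u < s.sup σ + 1 := fun u hu _ =>
      Nat.lt_succ_of_le (Finset.le_sup hu)
    -- The low-degree vertex goes last, so it adds to no other back-degree.
    refine ⟨Function.update σ v (s.sup σ + 1), ?_, ?_⟩
    · intro x hx y hy hxy
      by_cases hxv : x = v <;> by_cases hyv : y = v
      · rw [hxv, hyv]
      · subst hxv
        rw [Function.update_self, Function.update_of_ne hyv] at hxy
        exact absurd hxy (hlt y hy hyv).ne'
      · subst hyv
        rw [Function.update_self, Function.update_of_ne hxv] at hxy
        exact absurd hxy (hlt x hx hxv).ne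
      · rw [Function.update_of_ne hxv, Function.update_of_ne hyv] at hxy
        exact hσ (by simpa [hxv] using hx) (by simpa [hyv] using hy) hxy
    · intro x hx
      by_cases hxv : x = v
      · subst hxv
        refine le_trans ?_ hvd
        rw [← Function.Injective.encard_image (Subtype.val_injective (p := (· ∈ (s : Set V))))]
        refine Set.encard_le_encard ?_
        rintro u ⟨hu, hadj, -⟩
        exact ⟨⟨u, hu⟩, hadj, rfl⟩
      · refine le_trans (Set.encard_le_encard ?_) (hσd x (Finset.mem_erase.2 ⟨hxv, hx⟩))
        rintro u ⟨hu, hadj, hlt'⟩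
        rw [Function.update_of_ne hxv] at hlt'
        have huv : u ≠ v := by
          rintro rfl
          rw [Function.update_self] at hlt'
          exact absurd hlt' (hlt x hx hxv).not_gt
        rw [Function.update_of_ne huv] at hlt'
        exact ⟨Finset.mem_erase.2 ⟨huv, hu⟩, hadj, hlt'⟩

theorem exists_ordering_colouringNumber [Fintype V] (G : SimpleGraph V) :
    ∃ σ : V ≃ Fin (Fintype.card V),
    ∀ v : V, {u : V | G.Adj v u ∧ σ u < σ v}.encard < G.colouringNumber := by
  refine Nat.sInf_mem (s := {k : ℕ | ∃ σ : V ≃ Fin (Fintype.card V),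
    ∀ v : V, {u : V | G.Adj v u ∧ σ u < σ v}.encard < k})
    ⟨Fintype.card V + 1, Fintype.equivFin V, fun v => ?_⟩
  refine lt_of_le_of_lt (Set.encard_le_encard (Set.subset_univ _)) ?_
  rw [Set.encard_univ, ENat.card_eq_coe_fintype_card]
  exact_mod_cast Nat.lt_succ_self _

/-! ### The lexicographic edge order -/

/-- The lexicographic position of an edge with respect to a vertex numbering: first compare the
smaller end, then the larger one. -/
def edgeKey (σ : V → ℕ) (e : Sym2 V) : ℕ ×ₗ ℕ :=
  toLex ((e.map σ).inf, (e.map σ).sup)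

theorem edgeKey_injective {σ : V → ℕ} (hσ : Function.Injective σ) :
    Function.Injective (edgeKey σ) := by
  intro e f h
  refine Sym2.map.injective hσ ?_
  have h' := toLex.injective h
  exact Sym2.inf_eq_inf_and_sup_eq_sup.1 (Prod.mk.injEq _ _ _ _ ▸ h')

section

variable [Fintype V] [DecidableEq V] (G : SimpleGraph V) [DecidableRel G.Adj]

/-- In the lexicographic edge order of a numbering with back-degrees at most `d`, an edge is the
last one touching `e` for at most `Δ + d` edges `e`. -/
theorem exists_card_le_of_last_edgeTouch {σ : V → ℕ} (hσ : Function.Injective σ) {d : ℕ}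
    (hd : ∀ v, {u | G.Adj v u ∧ σ u < σ v}.encard ≤ d) {f : Sym2 V} (hf : f ∈ G.edgeSet) :
    ∃ B : Finset (Sym2 V), (∀ e ∈ G.edgeSet, EdgeTouch e f →
      (∀ g ∈ G.edgeSet, EdgeTouch e g → edgeKey σ g ≤ edgeKey σ f) → e ∈ B) ∧
      B.card ≤ G.maxDegree + d := by
  obtain ⟨a, b, hab, rfl⟩ : ∃ a b, σ a < σ b ∧ f = s(a, b) := by
    induction f with | _ a b
    rw [mem_edgeSet] at hf
    rcases lt_or_gt_of_ne (hσ.ne hf.ne) with h | h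
    · exact ⟨a, b, h, rfl⟩
    · exact ⟨b, a, h, Sym2.eq_swap⟩
  rw [mem_edgeSet] at hf
  classical
  let F : Finset V := {x | G.Adj b x ∧ σ b < σ x ∧
    ∀ g ∈ G.edgeSet, EdgeTouch s(b, x) g → edgeKey σ g ≤ edgeKey σ s(a, b)}
  let D : Finset V := {x | G.Adj b x ∧ σ x < σ b}
  -- For two forward edges bx and by, by touches bx and has smaller end b, hence comes after ab; so
  -- ab is not last for bx.
  have hF : F.card ≤ 1 := by
    refine Finset.card_le_one.2 fun x hx y hy => ?_
    by_contra hxy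
    simp only [F, Finset.mem_filter, Finset.mem_univ, true_and] at hx hy
    have h := hx.2.2 s(b, y) hy.1 ⟨fun h => hxy (Sym2.congr_right.1 h), b, by simp, by simp⟩
    rw [edgeKey, edgeKey, Prod.Lex.toLex_le_toLex] at h
    simp only [Sym2.map_mk, Sym2.inf_mk, Sym2.sup_mk] at h
    have := hy.2.1
    omega
  have hD : D.card ≤ d := by
    have := hd b
    rw [← Nat.cast_le (α := ℕ∞), ← Set.encard_coe_eq_coe_finsetCard]
    simpa [D] using this
  have hN : ((G.neighborFinset a).erase b).card + 1 ≤ G.maxDegree := by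
    rw [Finset.card_erase_add_one (by simpa using hf), card_neighborFinset_eq_degree]
    exact G.degree_le_maxDegree a
  -- The three counts are Δ - 1 at a, d backward at b and 1 forward at b.
  refine ⟨((G.neighborFinset a).erase b).image (fun x => s(a, x)) ∪
    (D ∪ F).image (fun x => s(b, x)), ?_, ?_⟩
  · rintro e he ⟨hne, v, hve, hvf⟩ hlast
    obtain ⟨x, rfl⟩ := hve
    rw [mem_edgeSet] at he
    rcases Sym2.mem_iff.1 hvf with rfl | rfl
    · refine Finset.mem_union_left _ (Finset.mem_image.2 ⟨x, ?_, rfl⟩)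
      rw [Finset.mem_erase, mem_neighborFinset]
      exact ⟨fun h => hne (by rw [h]), he⟩
    · refine Finset.mem_union_right _ (Finset.mem_image.2 ⟨x, ?_, rfl⟩)
      rcases lt_or_gt_of_ne (hσ.ne he.ne) with h | h
      · exact Finset.mem_union_right _ (by simpa [F] using ⟨he, h, hlast⟩)
      · exact Finset.mem_union_left _ (by simpa [D] using ⟨he, h⟩)
  · refine (Finset.card_union_le _ _).trans ?_
    have h1 := Finset.card_image_le (s := (G.neighborFinset a).erase b) (f := fun x => s(a, x))
    have h2 := Finset.card_image_le (s := D ∪ F) (f := fun x => s(b, x))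
    have h3 := Finset.card_union_le D F
    omega

theorem edgeSum_update_of_mem {f : Sym2 V} (w : Sym2 V → ℝ) (x : ℝ) {v : V}
    (hf : f ∈ G.edgeSet) (hv : v ∈ f) :
    G.edgeSum (Function.update w f x) v = x + ∑ e ∈ G.incidenceFinset v \ {f}, w e :=
  Finset.sum_update_of_mem (by rw [mem_incidenceFinset]; exact ⟨hf, hv⟩) _ _

theorem edgeSum_update_of_notMem {f : Sym2 V} (w : Sym2 V → ℝ) (x : ℝ) {v : V} (hv : v ∉ f) :
    G.edgeSum (Function.update w f x) v = G.edgeSum w v :=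
  Finset.sum_update_of_notMem (by rw [mem_incidenceFinset]; exact fun h => hv h.2) _ _

/-- A nice graph with a vertex ordering of back-degrees at most `d` is `(1, Δ + d + 1)`-weight
choosable. -/
theorem IsNice.isWeightChoosable_of_ordering {G : SimpleGraph V} [DecidableRel G.Adj]
    (hG : G.IsNice) {σ : V → ℕ} (hσ : Function.Injective σ) {d : ℕ}
    (hd : ∀ v, {u | G.Adj v u ∧ σ u < σ v}.encard ≤ d) :
    G.IsWeightChoosable 1 (G.maxDegree + d + 1) := by
  classical
  intro LV LE hLV hLE
  have hV : ∀ v, ∃ x, x ∈ LV v := fun v => Finset.card_pos.1 (by rw [hLV v]; exact one_pos)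
  choose wV hwV using hV
  have hlast : ∀ e ∈ G.edgeFinset, ∃ f ∈ G.edgeSet, EdgeTouch e f ∧
      ∀ g ∈ G.edgeSet, EdgeTouch e g → edgeKey σ g ≤ edgeKey σ f := by
    intro e he
    obtain ⟨f₀, hf₀, hef₀⟩ := hG.exists_edgeTouch (mem_edgeFinset.1 he)
    obtain ⟨f, hf, hmax⟩ := Finset.exists_max_image
      (G.edgeFinset.filter (EdgeTouch e)) (edgeKey σ)
      ⟨f₀, Finset.mem_filter.2 ⟨mem_edgeFinset.2 hf₀, hef₀⟩⟩
    obtain ⟨hf, hef⟩ := Finset.mem_filter.1 hf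
    exact ⟨f, mem_edgeFinset.1 hf, hef, fun g hg heg =>
      hmax g (Finset.mem_filter.2 ⟨mem_edgeFinset.2 hg, heg⟩)⟩
  choose! ρ hρ hρtouch hρmax using hlast
  -- The existential avoids orienting the edge; `hBad` removes it by symmetry.
  let Bad : Sym2 V → (Sym2 V → ℝ) → Prop := fun e w =>
    ∃ u v, e = s(u, v) ∧ wV u + G.edgeSum w u = wV v + G.edgeSum w v
  have hBad : ∀ u v w, Bad s(u, v) w ↔ wV u + G.edgeSum w u = wV v + G.edgeSum w v := by
    refine fun u v w => ⟨?_, fun h => ⟨u, v, rfl, h⟩⟩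
    rintro ⟨u', v', huv, h⟩
    rcases Sym2.eq_iff.1 huv with ⟨rfl, rfl⟩ | ⟨rfl, rfl⟩
    · exact h
    · exact h.symm
  suffices H : ∃ w : Sym2 V → ℝ, (∀ f ∈ G.edgeFinset, w f ∈ LE f) ∧
      ∀ e ∈ G.edgeFinset, ρ e ∈ G.edgeFinset → ¬ Bad e w by
    obtain ⟨w, hw, hgood⟩ := H
    refine ⟨wV, w, hwV, fun e he => hw e (mem_edgeFinset.2 he), fun u v huv h => ?_⟩
    have he : s(u, v) ∈ G.edgeFinset := mem_edgeFinset.2 huv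
    exact hgood _ he (mem_edgeFinset.2 (hρ _ he)) ((hBad u v w).2 h)
  refine exists_forall_mem_forall_not_bad (edgeKey σ) G.edgeFinset G.edgeFinset LE ρ Bad
    ?_ ?_ ?_
  · intro e he f hne hle w x
    have hnot : ¬ (f ∈ G.edgeSet ∧ EdgeTouch e f) := fun ⟨hf, hef⟩ =>
      hne (edgeKey_injective hσ (le_antisymm (hρmax e he f hf hef) hle))
    induction e with | _ u v
    rw [hBad, hBad]
    by_cases hf : f ∈ G.edgeSet
    · by_cases hfe : f = s(u, v)
      -- The edge's own weight enters both colours and cancels.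
      · have hu : u ∈ f := by simp [hfe]
        have hv : v ∈ f := by simp [hfe]
        have hwu := G.edgeSum_update_of_mem w (w f) hf hu
        have hwv := G.edgeSum_update_of_mem w (w f) hf hv
        rw [Function.update_eq_self] at hwu hwv
        rw [G.edgeSum_update_of_mem _ _ hf hu, G.edgeSum_update_of_mem _ _ hf hv, hwu, hwv]
        constructor <;> intro h <;> linarith
      · have hu : u ∉ f := fun h => hnot ⟨hf, Ne.symm hfe, u, by simp, h⟩
        have hv : v ∉ f := fun h => hnot ⟨hf, Ne.symm hfe, v, by simp, h⟩
        rw [G.edgeSum_update_of_notMem _ _ hu, G.edgeSum_update_of_notMem _ _ hv]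
    · have hs : ∀ z, G.edgeSum (Function.update w f x) z = G.edgeSum w z := fun z =>
        Finset.sum_update_of_notMem
          (by rw [mem_incidenceFinset]; exact fun h => hf h.1) _ _
      rw [hs, hs]
  · intro e he w x y hx hy
    have hf := hρ e he
    obtain ⟨hne, z, hze, hzf⟩ := hρtouch e he
    obtain ⟨z', rfl⟩ := hze
    have hzz' : z ≠ z' := ((mem_edgeSet G).1 (mem_edgeFinset.1 he)).ne
    -- Containing both ends would make `ρ e` equal to e.
    have hz'f : z' ∉ ρ s(z, z') := fun h => hne ((Sym2.mem_and_mem_iff hzz').1 ⟨hzf, h⟩).symm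
    rw [hBad, G.edgeSum_update_of_mem _ _ hf hzf, G.edgeSum_update_of_notMem _ _ hz'f] at hx hy
    linarith
  · intro f hf
    obtain ⟨B, hB, hcard⟩ := G.exists_card_le_of_last_edgeTouch hσ hd (mem_edgeFinset.1 hf)
    refine ⟨B, ?_, ?_⟩
    · rintro e he rfl
      exact hB e (mem_edgeFinset.1 he) (hρtouch e he) (hρmax e he)
    · rw [hLE f (mem_edgeFinset.1 hf)]
      omega

theorem IsNice.isWeightChoosable_colouringNumber {G : SimpleGraph V} [DecidableRel G.Adj]
    (hG : G.IsNice) : G.IsWeightChoosable 1 (G.maxDegree + G.colouringNumber) := by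
  obtain ⟨σ, hσ⟩ := G.exists_ordering_colouringNumber
  -- Without vertices the colouring number is 0, not of the form d + 1.
  rcases isEmpty_or_nonempty V with hV | ⟨⟨v₀⟩⟩
  · exact fun _ _ _ _ => ⟨fun _ => 0, fun _ => 0, fun v => hV.elim v,
      fun e => e.ind fun v => hV.elim v, fun v => hV.elim v⟩
  · obtain ⟨d, hd⟩ : ∃ d, G.colouringNumber = d + 1 := by
      refine Nat.exists_eq_succ_of_ne_zero fun h => ?_
      have := hσ v₀
      rw [h] at this
      simp at this
    rw [hd] at hσ ⊢
    refine hG.isWeightChoosable_of_ordering (σ := fun v => (σ v : ℕ))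
      (Fin.val_injective.comp σ.injective) fun v => ?_
    have := hσ v
    rw [Nat.cast_add, Nat.cast_one] at this
    exact Order.le_of_lt_add_one this

variable {G}

theorem IsWeightChoosable.isEdgeWeightChoosable {l : ℕ} (h : G.IsWeightChoosable 1 l) :
    G.IsEdgeWeightChoosable l := by
  intro LE hLE
  obtain ⟨wV, wE, hV, hE, hne⟩ := h (fun _ => {0}) LE (fun _ => Finset.card_singleton 0) hLE
  refine ⟨wE, hE, fun u v huv => ?_⟩
  simpa [Finset.mem_singleton.1 (hV u), Finset.mem_singleton.1 (hV v)] using hne u v huv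

end

end SimpleGraph

theorem mainTheorem2 {V : Type*} [Fintype V] [DecidableEq V] (G : SimpleGraph V)
    [DecidableRel G.Adj] (hG : G.IsNice) (d : ℕ) (hd : G.IsDegenerate d) :
    G.IsWeightChoosable 1 (G.maxDegree + d + 1) ∧
      G.IsWeightChoosable 1 (G.maxDegree + G.colouringNumber) ∧
      G.edgeWeightChoosabilityNumber ≤ ((G.maxDegree + d + 1 : ℕ) : ℕ∞) := by
  obtain ⟨σ, hσ, hσd⟩ := hd.exists_ordering
  have h := hG.isWeightChoosable_of_ordering hσ hσd
  exact ⟨h, hG.isWeightChoosable_colouringNumber, iInf₂_le _ h.isEdgeWeightChoosable⟩
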